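/- Let $0<q<1$ and $q^*=2-q$. For $p\in\{q,q^*\}$ put $\exp_p(u)=[1+(1-p)u]_+^{1/(1-p)}\in[0,+\infty]$ (with $0$ to a negative power equal to $+\infty$, and $\exp_p(\pm\infty)$ defined as the limits) and $\ln_p(u)=\frac{u^{1-p}-1}{1-p}$ for $u>0$. Let $X_1,X_2,\dots$ be i.i.d. real-valued random variables and assume that $A(a)=\mathbb E\exp_q(aX_1)$ is finite for all $a>0$. Put $\theta(a)=a/A(a)^{1-q}$ for $a>0$ (equal to $+\infty$ if $A(a)=0$) and $\overline\theta=\lim_{a\to\infty}\theta(a)\le+\infty$. On $\{a>0: A(a)>0\}$ the function $\theta$ is strictly increasing with range $(0,\overline\theta)$; for $0<\theta<\overline\theta$ put $\Phi(\theta)=\ln_{q^*}A(a)$, where $a>0$ is determined by $\theta(a)=\theta$. Let $$I(x)=\sup\{\theta x-\Phi(\theta):\ 0<\theta<\overline\theta\}\le+\infty .$$ Then there exist functions $\xi_n:\mathbb R\to[0,+\infty]$, $n\ge1$, such that for all $x\in\mathbb R$ and all $n\ge 1$ $$\mathrm{Prob}\Big(\frac1n\sum_{k=1}^nX_k\ge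 x\Big)\le\xi_n(x),$$ and such that for every $x\in\mathbb R$ $$\xi_n(x)\sim n\,\exp_{q^*}\Big(\frac nq-nI(x)\Big)\qquad(n\to\infty).$$ Here $f_n\sim g_n$ for sequences in $[0,+\infty]$ means that $f_n=u_ng_n$ for all large $n$, for some $u_n\to1$. -/

import Mathlib

open MeasureTheory ProbabilityTheory Filter Topology
open scoped ENNReal

namespace QDeformed

noncomputable section

/-- The `q`-deformed exponential `exp_q(u) = [1 + (1 - q) u]_+ ^ (1 / (1 - q))`, with values in
`[0, +∞]`. It is extended to `u = ±∞` by its limits. For `q > 1` the exponent is negative, and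
`0` to a negative power is `+∞`. -/
def qExp (q : ℝ) (u : EReal) : ℝ≥0∞ :=
  (1 + ((1 - q : ℝ) : EReal) * u).toENNReal ^ (1 / (1 - q))

/-- The `q`-deformed logarithm `ln_q(u) = (u ^ (1 - q) - 1) / (1 - q)`, for `u > 0`. -/
def qLog (q : ℝ) (u : ℝ) : ℝ :=
  (u ^ (1 - q) - 1) / (1 - q)

variable {Ω : Type*} [MeasurableSpace Ω]

/-- The `q`-deformed generating function `A(a) = E exp_q(a X)`, with values in `[0, +∞]`. -/
def genFun (q : ℝ) (P : Measure Ω) (X : Ω → ℝ) (a : ℝ) : ℝ≥0∞ :=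
  ∫⁻ ω, qExp q ((a * X ω : ℝ) : EReal) ∂P

/-- The parameter `θ(a) = a / A(a) ^ (1 - q)`. It is `+∞` if `A(a) = 0`. -/
def theta (q : ℝ) (P : Measure Ω) (X : Ω → ℝ) (a : ℝ) : ℝ≥0∞ :=
  ENNReal.ofReal a / genFun q P X a ^ (1 - q)

/-- The limit `θ̄` of `θ(a)` as `a → ∞` (the limit exists since `θ` is increasing in `a`). -/
def thetaBar (q : ℝ) (P : Measure Ω) (X : Ω → ℝ) : ℝ≥0∞ :=
  limsup (theta q P X) atTop

/-- The inverse `a(θ)` of `a ↦ θ(a)`, `a > 0`. -/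
def aOfTheta (q : ℝ) (P : Measure Ω) (X : Ω → ℝ) (t : ℝ) : ℝ :=
  Function.invFunOn (theta q P X) (Set.Ioi 0) (ENNReal.ofReal t)

/-- `Φ(θ) = ln_{q*} A(a(θ))` with `q* = 2 - q`, for `0 < θ < θ̄`. -/
def Phi (q : ℝ) (P : Measure Ω) (X : Ω → ℝ) (t : ℝ) : ℝ :=
  qLog (2 - q) (genFun q P X (aOfTheta q P X t)).toReal

/-- The rate function `I(x) = sup {θ x - Φ(θ) : 0 < θ < θ̄}`, possibly `+∞`. -/
def rate (q : ℝ) (P : Measure Ω) (X : Ω → ℝ) (x : ℝ) : EReal :=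
  ⨆ t ∈ {t : ℝ | 0 < t ∧ ENNReal.ofReal t < thetaBar q P X},
    ((t * x - Phi q P X t : ℝ) : EReal)

/-- Asymptotic equivalence `f n ~ g n` as `n → ∞` of sequences in `[0, +∞]`: the quotient tends
to `1`. Where `g n` is `0` or `+∞`, this forces `f n = g n` for all large `n`. -/
def AsympEquiv (f g : ℕ → ℝ≥0∞) : Prop :=
  ∃ u : ℕ → ℝ≥0∞, Tendsto u atTop (𝓝 1) ∧ ∀ᶠ n in atTop, f n = u n * g n

end

end QDeformed

/-! Let `p = 1 / (1 - q)` and `Z = [1 + (1 - q) a X]_+`. Then `A(a) ^ (1 - q)` is the norm `N(a)` of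
`Z` in `L^p`, `θ(a) = a / N(a)`, and for `θ = θ(a)`
`θ x - Φ(θ) = ((1 + (1 - q) a x) / N(a) - 1) / (1 - q)`.
So if `I(x) > 0`, then `E Z ≤ N(a) < r := 1 + (1 - q) a x` for some `a`, and a sample mean of `X`
above `x` forces the corresponding sample mean of `Z` above `r > E Z`. For i.i.d. nonnegative
variables in `L^p` this has probability `o(n ^ (1 - p))`: a single summand exceeds `δ n` with
probability `o(n ^ (-p))`, and Chernoff's bound applies to the summands truncated at `δ n`.

If `1 / q < I(x) < ∞`, the quantity `n exp_{q*}(n / q - n I(x))` is at least a positive multiple of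
`n ^ (1 - p)`. If `I(x) ≤ 1 / q`, it is at least `1`. If `I(x) = ∞`, Markov's inequality shows that
`X < x` almost surely. In each case the quantity bounds the probability for all large `n`, and
`ξ_n(x)` can be taken as the maximum of the two.
-/

section HeavyTail

variable {Ω : Type*} [MeasurableSpace Ω] {P : Measure Ω}

theorem exp_le_one_add_add_rpow_mul_exp {y p : ℝ} (hy : 0 ≤ y) (hp0 : 0 ≤ p) (hp2 : p ≤ 2) :
    Real.exp y ≤ 1 + y + y ^ p * Real.exp y := by
  have hexp : 1 ≤ Real.exp y := Real.one_le_exp hy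
  rcases le_total y 1 with h | h
  · have hquad : |Real.exp y - 1 - y| ≤ y ^ (2 : ℝ) := by
      simpa only [Real.rpow_two] using
        Real.abs_exp_sub_one_sub_id_le (by rwa [abs_of_nonneg hy])
    have hpow : y ^ (2 : ℝ) ≤ y ^ p := Real.rpow_le_rpow_of_exponent_ge' hy h hp0 hp2
    have hmul : y ^ p ≤ y ^ p * Real.exp y := le_mul_of_one_le_right (by positivity) hexp
    linarith [(abs_le.1 hquad).2]
  · have hpow : 1 ≤ y ^ p := Real.one_le_rpow h hp0
    nlinarith

theorem tendsto_rpow_mul_measureReal_lt_norm {E : Type*} [NormedAddCommGroup E] {Z : Ω → E}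
    {α : ℝ} (hα : 0 < α) (hZ : MemLp Z (ENNReal.ofReal α) P) :
    Tendsto (fun t : ℝ => t ^ α * P.real {ω | t < ‖Z ω‖}) atTop (𝓝 0) := by
  have hmeas (t : ℝ) : NullMeasurableSet {ω | t < ‖Z ω‖} P :=
    nullMeasurableSet_lt aemeasurable_const hZ.aestronglyMeasurable.norm.aemeasurable
  have hint : Integrable (fun ω => ‖Z ω‖ ^ α) P := by
    simpa [ENNReal.toReal_ofReal hα.le] using
      hZ.integrable_norm_rpow (by simpa using hα) ENNReal.ofReal_ne_top
  have hlim : Tendsto (fun t : ℝ => ∫ ω, Set.indicator {ω | t < ‖Z ω‖} (fun _ => t ^ α) ω ∂P)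
      atTop (𝓝 (∫ _, (0 : ℝ) ∂P)) := by
    refine tendsto_integral_filter_of_dominated_convergence (fun ω => ‖Z ω‖ ^ α)
      (Eventually.of_forall fun t => aestronglyMeasurable_const.indicator₀ (hmeas t)) ?_ hint
      (ae_of_all _ fun ω => tendsto_const_nhds.congr' ?_)
    · filter_upwards [eventually_ge_atTop 0] with t ht
      refine ae_of_all _ fun ω => ?_
      by_cases h : ω ∈ {ω | t < ‖Z ω‖}
      · rw [Set.indicator_of_mem h, Real.norm_of_nonneg (by positivity)]
        exact Real.rpow_le_rpow ht (le_of_lt h) hα.le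
      · rw [Set.indicator_of_notMem h, norm_zero]
        positivity
    · filter_upwards [eventually_ge_atTop ‖Z ω‖] with t ht
      rw [Set.indicator_of_notMem (by simpa using ht)]
  rw [integral_zero] at hlim
  refine hlim.congr fun t => ?_
  rw [integral_indicator₀ (hmeas t), setIntegral_const, smul_eq_mul, mul_comm]

theorem integrable_exp_mul_min_const [IsFiniteMeasure P] {Z : Ω → ℝ} (hZ : AEMeasurable Z P)
    {s : ℝ} (hs : 0 ≤ s) (K : ℝ) : Integrable (fun ω => Real.exp (s * min (Z ω) K)) P := by
  refine Integrable.of_bound (by fun_prop) (Real.exp (s * K)) (ae_of_all _ fun ω => ?_)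
  rw [Real.norm_of_nonneg (Real.exp_pos _).le]
  gcongr
  exact min_le_right _ _

theorem mgf_min_const_le [IsProbabilityMeasure P] {Z : Ω → ℝ} (hnn : 0 ≤ᵐ[P] Z) {p : ℝ}
    (hp1 : 1 ≤ p) (hp2 : p ≤ 2) (hZ : MemLp Z (ENNReal.ofReal p) P) {s K : ℝ} (hs : 0 ≤ s)
    (hK : 0 ≤ K) :
    mgf (fun ω => min (Z ω) K) P s ≤
      Real.exp (s * ∫ ω, Z ω ∂P + s ^ p * Real.exp (s * K) * ∫ ω, ‖Z ω‖ ^ p ∂P) := by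
  have hp0 : 0 < p := by linarith
  have hint : Integrable Z P := hZ.integrable (by simpa using hp1)
  have hintp : Integrable (fun ω => ‖Z ω‖ ^ p) P := by
    simpa [ENNReal.toReal_ofReal hp0.le] using
      hZ.integrable_norm_rpow (by simpa using hp0) ENNReal.ofReal_ne_top
  set C := s ^ p * Real.exp (s * K)
  have hpointwise : ∀ᵐ ω ∂P, Real.exp (s * min (Z ω) K) ≤ 1 + s * Z ω + C * ‖Z ω‖ ^ p := by
    filter_upwards [hnn] with ω (hω : 0 ≤ Z ω)
    have hmin : 0 ≤ min (Z ω) K := le_min hω hK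
    calc Real.exp (s * min (Z ω) K)
        ≤ 1 + s * min (Z ω) K
            + (s * min (Z ω) K) ^ p * Real.exp (s * min (Z ω) K) :=
          exp_le_one_add_add_rpow_mul_exp (mul_nonneg hs hmin) hp0.le hp2
      _ ≤ 1 + s * Z ω + (s * Z ω) ^ p * Real.exp (s * K) := by
          gcongr
          exacts [min_le_left _ _, min_le_left _ _, min_le_right _ _]
      _ = 1 + s * Z ω + C * ‖Z ω‖ ^ p := by
          rw [Real.mul_rpow hs hω, mul_right_comm, Real.norm_of_nonneg hω]
  calc mgf (fun ω => min (Z ω) K) P s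
      ≤ ∫ ω, (1 + s * Z ω + C * ‖Z ω‖ ^ p) ∂P :=
        integral_mono_ae (integrable_exp_mul_min_const hint.aemeasurable hs K)
          (((integrable_const 1).add (hint.const_mul s)).add (hintp.const_mul C)) hpointwise
    _ = s * ∫ ω, Z ω ∂P + C * ∫ ω, ‖Z ω‖ ^ p ∂P + 1 := by
        rw [integral_add (by fun_prop) (hintp.const_mul C),
          integral_add (by fun_prop) (by fun_prop), integral_const_mul, integral_const_mul,
          integral_const, probReal_univ, one_smul]
        ring
    _ ≤ _ := Real.add_one_le_exp _

theorem measureReal_le_sum_min_const_le [IsProbabilityMeasure P] {Z : ℕ → Ω → ℝ}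
    (hindep : iIndepFun Z P) (hident : ∀ k, IdentDistrib (Z k) (Z 0) P P) {s : ℝ} (hs : 0 ≤ s)
    (K x : ℝ) (n : ℕ) :
    P.real {ω | x ≤ ∑ k ∈ Finset.range n, min (Z k ω) K} ≤
      Real.exp (-s * x) * mgf (fun ω => min (Z 0 ω) K) P s ^ n := by
  have hZ (k : ℕ) : AEMeasurable (Z k) P := (hident k).aemeasurable_fst
  set W : ℕ → Ω → ℝ := fun k ω => min (Z k ω) K
  have hW (k : ℕ) : AEMeasurable (W k) P := (hZ k).min aemeasurable_const
  have hWindep : iIndepFun W P := hindep.comp (fun _ z => min z K) fun _ => by fun_prop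
  have hWident (k : ℕ) : IdentDistrib (W k) (W 0) P P :=
    (hident k).comp (u := fun z => min z K) (by fun_prop)
  have hmgf : mgf (∑ k ∈ Finset.range n, W k) P s = mgf (W 0) P s ^ n := by
    rw [hWindep.mgf_sum₀ hW, Finset.prod_eq_pow_card fun k _ =>
      mgf_congr_of_identDistrib (W k) (W 0) (hWident k) s, Finset.card_range]
  have hint : Integrable (fun ω => Real.exp (s * (∑ k ∈ Finset.range n, W k) ω)) P := by
    refine Integrable.of_bound (by fun_prop) (Real.exp (s * (n * K))) (ae_of_all _ fun ω => ?_)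
    rw [Real.norm_of_nonneg (Real.exp_pos _).le, Finset.sum_apply]
    gcongr
    simpa using Finset.sum_le_card_nsmul (Finset.range n) (W · ω) K fun k _ => min_le_right _ _
  simpa only [hmgf, Finset.sum_apply] using measure_ge_le_exp_mul_mgf x hs hint

theorem measureReal_natCast_mul_le_sum_min_const_le [IsProbabilityMeasure P] {Z : ℕ → Ω → ℝ}
    (hindep : iIndepFun Z P) (hident : ∀ k, IdentDistrib (Z k) (Z 0) P P)
    (hnn : 0 ≤ᵐ[P] Z 0) {p : ℝ} (hp1 : 1 ≤ p) (hp2 : p ≤ 2)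
    (hZp : MemLp (Z 0) (ENNReal.ofReal p) P) {s K : ℝ} (hs : 0 ≤ s) (hK : 0 ≤ K) (r : ℝ) (n : ℕ) :
    P.real {ω | n * r ≤ ∑ k ∈ Finset.range n, min (Z k ω) K} ≤
      Real.exp (-(s * n * (r - ∫ ω, Z 0 ω ∂P)) +
        n * (s ^ p * Real.exp (s * K)) * ∫ ω, ‖Z 0 ω‖ ^ p ∂P) := by
  set m := ∫ ω, Z 0 ω ∂P
  set M := ∫ ω, ‖Z 0 ω‖ ^ p ∂P
  calc P.real {ω | n * r ≤ ∑ k ∈ Finset.range n, min (Z k ω) K}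
      ≤ Real.exp (-s * (n * r)) * mgf (fun ω => min (Z 0 ω) K) P s ^ n :=
        measureReal_le_sum_min_const_le hindep hident hs K (n * r) n
    _ ≤ Real.exp (-s * (n * r)) * Real.exp (s * m + s ^ p * Real.exp (s * K) * M) ^ n := by
        gcongr
        exacts [mgf_nonneg, mgf_min_const_le hnn hp1 hp2 hZp hs hK]
    _ = Real.exp (-(s * n * (r - m)) + n * (s ^ p * Real.exp (s * K)) * M) := by
        rw [← Real.exp_nat_mul, ← Real.exp_add]
        ring_nf

theorem measureReal_le_sum_le_add_sum_min_const [IsFiniteMeasure P] {Z : ℕ → Ω → ℝ}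
    (hident : ∀ k, IdentDistrib (Z k) (Z 0) P P) (K x : ℝ) (n : ℕ) :
    P.real {ω | x ≤ ∑ k ∈ Finset.range n, Z k ω} ≤
      n * P.real {ω | K < Z 0 ω} + P.real {ω | x ≤ ∑ k ∈ Finset.range n, min (Z k ω) K} := by
  have hcover : {ω | x ≤ ∑ k ∈ Finset.range n, Z k ω} ⊆
      (⋃ k ∈ Finset.range n, {ω | K < Z k ω}) ∪
        {ω | x ≤ ∑ k ∈ Finset.range n, min (Z k ω) K} := by
    intro ω hω
    by_cases h : ∃ k ∈ Finset.range n, K < Z k ω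
    · obtain ⟨k, hk, hKk⟩ := h
      exact Or.inl (Set.mem_biUnion hk hKk)
    · push Not at h
      have hsum : ∑ k ∈ Finset.range n, min (Z k ω) K = ∑ k ∈ Finset.range n, Z k ω :=
        Finset.sum_congr rfl fun k hk => min_eq_left (h k hk)
      exact Or.inr (le_of_le_of_eq hω hsum.symm)
  have hunion : P.real (⋃ k ∈ Finset.range n, {ω | K < Z k ω}) ≤ n * P.real {ω | K < Z 0 ω} := by
    have hterm (k : ℕ) : P.real {ω | K < Z k ω} = P.real {ω | K < Z 0 ω} :=
      congrArg ENNReal.toReal ((hident k).measure_mem_eq measurableSet_Ioi)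
    refine (measureReal_biUnion_finset_le _ _).trans_eq ?_
    simp only [hterm, Finset.sum_const, Finset.card_range, nsmul_eq_mul]
  exact (measureReal_mono hcover).trans ((measureReal_union_le _ _).trans (by gcongr))

theorem tendsto_mul_log_div_rpow_mul_exp_atTop {l δ p : ℝ} (hl : 0 ≤ l) (hδ : l * δ < p - 1) :
    Tendsto (fun x : ℝ => x * ((l * Real.log x / x) ^ p * Real.exp (l * Real.log x / x * (δ * x))))
      atTop (𝓝 0) := by
  have hlim : Tendsto (fun x : ℝ => l ^ p * (Real.log x ^ p / x ^ (p - 1 - l * δ))) atTop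
      (𝓝 0) := by
    simpa using ((isLittleO_log_rpow_rpow_atTop p (sub_pos.2 hδ)).tendsto_div_nhds_zero).const_mul
      (l ^ p)
  refine hlim.congr' ?_
  filter_upwards [eventually_ge_atTop 1] with x hx
  have hx0 : 0 < x := by linarith
  have hlog : 0 ≤ Real.log x := Real.log_nonneg hx
  have hexp : Real.exp (l * Real.log x / x * (δ * x)) = x ^ (l * δ) := by
    rw [Real.rpow_def_of_pos hx0]
    congr 1
    field_simp
  rw [hexp, Real.div_rpow (by positivity) hx0.le, Real.mul_rpow hl hlog, Real.rpow_sub hx0,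
    Real.rpow_sub hx0, Real.rpow_one]
  field_simp

theorem exists_tendsto_rpow_mul_measureReal_sum_min [IsProbabilityMeasure P] {Z : ℕ → Ω → ℝ}
    (hindep : iIndepFun Z P) (hident : ∀ k, IdentDistrib (Z k) (Z 0) P P)
    (hnn : 0 ≤ᵐ[P] Z 0) {p : ℝ} (hp : 1 < p) (hZp : MemLp (Z 0) (ENNReal.ofReal p) P)
    {r : ℝ} (hr : ∫ ω, Z 0 ω ∂P < r) (β : ℝ) :
    ∃ δ > 0, Tendsto (fun n : ℕ => (n : ℝ) ^ β *
      P.real {ω | n * r ≤ ∑ k ∈ Finset.range n, min (Z k ω) (δ * n)}) atTop (𝓝 0) := by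
  wlog hp2 : p ≤ 2 generalizing p
  · exact this one_lt_two (hZp.mono_exponent (ENNReal.ofReal_le_ofReal (not_le.1 hp2).le)) le_rfl
  have hrm : 0 < r - ∫ ω, Z 0 ω ∂P := sub_pos.2 hr
  -- The tilt `l log n / n` gives the factor `n ^ (-(|β| + 1))`, at the price of an error `error n`.
  set l := (|β| + 1) / (r - ∫ ω, Z 0 ω ∂P) with hl_def
  have hl : 0 < l := by positivity
  obtain ⟨δ, hδ, hlδ⟩ : ∃ δ > 0, l * δ < p - 1 := by
    refine ⟨(p - 1) / (2 * l), div_pos (by linarith) (by positivity), ?_⟩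
    field_simp
    linarith
  refine ⟨δ, hδ, ?_⟩
  set error : ℕ → ℝ := fun n => n * ((l * Real.log n / n) ^ p *
    Real.exp (l * Real.log n / n * (δ * n))) * ∫ ω, ‖Z 0 ω‖ ^ p ∂P
  have herror : Tendsto error atTop (𝓝 0) := by
    simpa only [Function.comp_def, zero_mul] using
      ((tendsto_mul_log_div_rpow_mul_exp_atTop hl.le hlδ).comp
        tendsto_natCast_atTop_atTop).mul_const (∫ ω, ‖Z 0 ω‖ ^ p ∂P)
  have hbound : Tendsto (fun n : ℕ => ((n : ℝ))⁻¹ * Real.exp (error n)) atTop (𝓝 0) := by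
    simpa using tendsto_inv_atTop_nhds_zero_nat.mul ((Real.continuous_exp.tendsto 0).comp herror)
  refine squeeze_zero' (Eventually.of_forall fun n => by positivity) ?_ hbound
  filter_upwards [eventually_ge_atTop 1] with n hn
  have hn1 : (1 : ℝ) ≤ n := by exact_mod_cast hn
  have hn0 : (0 : ℝ) < n := by linarith
  have hs : 0 ≤ l * Real.log n / n := by have := Real.log_nonneg hn1; positivity
  have htilt : -(l * Real.log n / n * n * (r - ∫ ω, Z 0 ω ∂P)) = Real.log n * -(|β| + 1) := by
    rw [hl_def]
    field_simp
  have hchernoff := measureReal_natCast_mul_le_sum_min_const_le hindep hident hnn hp.le hp2 hZp hs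
    (K := δ * n) (by positivity) r n
  rw [htilt, Real.exp_add, ← Real.rpow_def_of_pos hn0] at hchernoff
  calc (n : ℝ) ^ β * P.real {ω | n * r ≤ ∑ k ∈ Finset.range n, min (Z k ω) (δ * n)}
      ≤ (n : ℝ) ^ |β| * ((n : ℝ) ^ (-(|β| + 1)) * Real.exp (error n)) := by
        gcongr
        exact le_abs_self β
    _ = (n : ℝ)⁻¹ * Real.exp (error n) := by
        rw [← mul_assoc, ← Real.rpow_add hn0, ← Real.rpow_neg_one]
        ring_nf

theorem tendsto_rpow_mul_measureReal_le_sum [IsProbabilityMeasure P] {Z : ℕ → Ω → ℝ}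
    (hindep : iIndepFun Z P) (hident : ∀ k, IdentDistrib (Z k) (Z 0) P P)
    (hnn : 0 ≤ᵐ[P] Z 0) {α : ℝ} (hα : 1 < α) (hZα : MemLp (Z 0) (ENNReal.ofReal α) P)
    {r : ℝ} (hr : ∫ ω, Z 0 ω ∂P < r) :
    Tendsto (fun n : ℕ => (n : ℝ) ^ (α - 1) * P.real {ω | n * r ≤ ∑ k ∈ Finset.range n, Z k ω})
      atTop (𝓝 0) := by
  obtain ⟨δ, hδ, hsmall⟩ :=
    exists_tendsto_rpow_mul_measureReal_sum_min hindep hident hnn hα hZα hr (α - 1)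
  have hbig : Tendsto (fun n : ℕ => δ ^ (-α) *
      ((δ * n) ^ α * P.real {ω | δ * n < ‖Z 0 ω‖})) atTop (𝓝 0) := by
    simpa using ((tendsto_rpow_mul_measureReal_lt_norm (by linarith) hZα).comp
      (tendsto_natCast_atTop_atTop.const_mul_atTop hδ)).const_mul (δ ^ (-α))
  refine squeeze_zero' (Eventually.of_forall fun n => by positivity) ?_
    (by simpa using hbig.add hsmall)
  filter_upwards [eventually_ge_atTop 1] with n hn
  have hn0 : (0 : ℝ) < n := by exact_mod_cast hn
  have htail : P.real {ω | δ * n < Z 0 ω} ≤ P.real {ω | δ * n < ‖Z 0 ω‖} :=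
    measureReal_mono fun ω hω => lt_of_lt_of_le hω (Real.le_norm_self _)
  calc (n : ℝ) ^ (α - 1) * P.real {ω | n * r ≤ ∑ k ∈ Finset.range n, Z k ω}
      ≤ (n : ℝ) ^ (α - 1) * (n * P.real {ω | δ * n < ‖Z 0 ω‖} +
          P.real {ω | n * r ≤ ∑ k ∈ Finset.range n, min (Z k ω) (δ * n)}) := by
        gcongr
        exact (measureReal_le_sum_le_add_sum_min_const hident (δ * n) (n * r) n).trans
          (by gcongr)
    _ = δ ^ (-α) * ((δ * n) ^ α * P.real {ω | δ * n < ‖Z 0 ω‖}) + (n : ℝ) ^ (α - 1) *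
          P.real {ω | n * r ≤ ∑ k ∈ Finset.range n, min (Z k ω) (δ * n)} := by
        rw [mul_add, ← mul_assoc, ← Real.rpow_add_one hn0.ne', sub_add_cancel,
          Real.mul_rpow hδ.le hn0.le, Real.rpow_neg hδ.le, mul_assoc (δ ^ α),
          inv_mul_cancel_left₀ (by positivity)]

end HeavyTail

namespace QDeformed

section DeformedFunctions

theorem qExp_zero (q : ℝ) : qExp q 0 = 1 := by
  have hone : (1 : EReal).toENNReal = 1 := EReal.toENNReal_coe (x := 1)
  simp [qExp, hone]

theorem monotone_qExp {q : ℝ} (hq : q ≤ 1) : Monotone (qExp q) := fun u v huv => by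
  have hq0 : (0 : EReal) ≤ ((1 - q : ℝ) : EReal) := by exact_mod_cast sub_nonneg.2 hq
  exact ENNReal.rpow_le_rpow (EReal.toENNReal_le_toENNReal
    (add_le_add_right (mul_le_mul_of_nonneg_left huv hq0) 1)) (one_div_nonneg.2 (sub_nonneg.2 hq))

theorem qExp_two_sub (q : ℝ) (u : EReal) : qExp (2 - q) u = (qExp q (-u))⁻¹ := by
  have hcoeff : 1 - (2 - q) = -(1 - q) := by ring
  rw [qExp, qExp, ← ENNReal.rpow_neg, hcoeff, EReal.coe_neg, neg_mul, mul_neg,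
    one_div_neg_eq_neg_one_div]

theorem qLog_two_sub (q : ℝ) {u : ℝ} (hu : 0 ≤ u) :
    qLog (2 - q) u = (1 - (u ^ (1 - q))⁻¹) / (1 - q) := by
  have hcoeff : 1 - (2 - q) = -(1 - q) := by ring
  rw [qLog, hcoeff, Real.rpow_neg hu, div_neg, ← neg_div, neg_sub]

/-- The base `[1 + (1 - q) u]_+` of the power `exp_q(u)`, for real `u`. Truncating it at `0` makes
the moments of `[1 + (1 - q) a X]_+` those of a nonnegative random variable. -/
def qBase (q u : ℝ) : ℝ := max (1 + (1 - q) * u) 0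

theorem qBase_nonneg (q u : ℝ) : 0 ≤ qBase q u := le_max_right _ _

theorem continuous_qBase (q : ℝ) : Continuous (qBase q) := by
  unfold qBase
  fun_prop

theorem qExp_coe (q u : ℝ) : qExp q u = ENNReal.ofReal (qBase q u) ^ (1 / (1 - q)) := by
  have hcoe : (1 : EReal) + ((1 - q : ℝ) : EReal) * u = ((1 + (1 - q) * u : ℝ) : EReal) := by
    push_cast
    rfl
  rw [qExp, hcoe, EReal.real_coe_toENNReal, qBase, ENNReal.ofReal_max, ENNReal.ofReal_zero,
    max_eq_left zero_le]

theorem continuous_qExp_coe (q : ℝ) : Continuous fun u : ℝ => qExp q u := by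
  simp only [qExp_coe]
  exact ENNReal.continuous_rpow_const.comp
    (ENNReal.continuous_ofReal.comp (continuous_qBase q))

theorem qExp_coe_ne_top {q : ℝ} (hq : q ≤ 1) (u : ℝ) : qExp q u ≠ ∞ := by
  rw [qExp_coe]
  exact ENNReal.rpow_ne_top_of_nonneg (one_div_nonneg.2 (sub_nonneg.2 hq)) ENNReal.ofReal_ne_top

theorem qExp_rpow_one_sub {q : ℝ} (hq : q ≠ 1) (u : ℝ) :
    qExp q u ^ (1 - q) = ENNReal.ofReal (qBase q u) := by
  rw [qExp_coe, ← ENNReal.rpow_mul, one_div_mul_cancel (sub_ne_zero.2 hq.symm), ENNReal.rpow_one]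

theorem qExp_mul_le {q : ℝ} (hq : q ≤ 1) {c : ℝ} (hc : 1 ≤ c) (u : ℝ) :
    qExp q ((c * u : ℝ) : EReal) ≤ ENNReal.ofReal c ^ (1 / (1 - q)) * qExp q u := by
  have hbase : qBase q (c * u) ≤ c * qBase q u := by
    refine max_le ?_ (mul_nonneg (by linarith) (qBase_nonneg q u))
    calc 1 + (1 - q) * (c * u) ≤ c * (1 + (1 - q) * u) := by linarith
      _ ≤ c * qBase q u := by gcongr; exact le_max_left _ _
  have hexponent : 0 ≤ 1 / (1 - q) := one_div_nonneg.2 (sub_nonneg.2 hq)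
  rw [qExp_coe, qExp_coe, ← ENNReal.mul_rpow_of_nonneg _ _ hexponent,
    ← ENNReal.ofReal_mul (by linarith)]
  gcongr

theorem one_le_natCast_mul_qExp_two_sub {q : ℝ} (hq : q ≤ 1) {u : EReal} (hu : 0 ≤ u) {n : ℕ}
    (hn : 1 ≤ n) : 1 ≤ (n : ℝ≥0∞) * qExp (2 - q) u := by
  have hexp : qExp q (-u) ≤ 1 :=
    (monotone_qExp hq (EReal.neg_le_zero.2 hu)).trans_eq (qExp_zero q)
  rw [qExp_two_sub]
  exact one_le_mul (by exact_mod_cast hn) (ENNReal.one_le_inv.2 hexp)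

end DeformedFunctions

section GeneratingFunction

variable {Ω : Type*} [MeasurableSpace Ω] {P : Measure Ω} {X : Ω → ℝ} {q : ℝ}

/-- The norm of `[1 + (1 - q) a X]_+` in `L^p`, where `p = 1 / (1 - q)`. It equals
`A(a) ^ (1 - q)`, so that `θ(a) = a / qNorm q P X a`. -/
noncomputable def qNorm (q : ℝ) (P : Measure Ω) (X : Ω → ℝ) (a : ℝ) : ℝ≥0∞ :=
  eLpNorm (fun ω => qBase q (a * X ω)) (ENNReal.ofReal (1 / (1 - q))) P

theorem genFun_rpow_one_sub (hq : q < 1) (P : Measure Ω) (X : Ω → ℝ) (a : ℝ) :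
    genFun q P X a ^ (1 - q) = qNorm q P X a := by
  have hpos : 0 < 1 / (1 - q) := one_div_pos.2 (sub_pos.2 hq)
  simp only [genFun, qNorm, qExp_coe]
  rw [eLpNorm_eq_lintegral_rpow_enorm_toReal (by simpa using hq) ENNReal.ofReal_ne_top,
    ENNReal.toReal_ofReal hpos.le, one_div_one_div]
  simp only [Real.enorm_of_nonneg (qBase_nonneg _ _)]

theorem toReal_genFun_rpow_one_sub (hq : q < 1) (P : Measure Ω) (X : Ω → ℝ) (a : ℝ) :
    (genFun q P X a).toReal ^ (1 - q) = (qNorm q P X a).toReal := by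
  rw [ENNReal.toReal_rpow, genFun_rpow_one_sub hq]

theorem theta_eq_div_qNorm (hq : q < 1) (P : Measure Ω) (X : Ω → ℝ) (a : ℝ) :
    theta q P X a = ENNReal.ofReal a / qNorm q P X a := by
  rw [theta, genFun_rpow_one_sub hq]

theorem memLp_qBase_of_genFun_lt_top (hX : AEMeasurable X P) (hq : q < 1) {a : ℝ}
    (hA : genFun q P X a < ∞) :
    MemLp (fun ω => qBase q (a * X ω)) (ENNReal.ofReal (1 / (1 - q))) P := by
  refine ⟨((continuous_qBase q).measurable.comp_aemeasurable
    (hX.const_mul a)).aestronglyMeasurable, ?_⟩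
  change qNorm q P X a < ∞
  rw [← genFun_rpow_one_sub hq]
  exact ENNReal.rpow_lt_top_of_nonneg (sub_nonneg.2 hq.le) hA.ne

theorem integral_qBase_le_toReal_qNorm [IsProbabilityMeasure P] (hX : AEMeasurable X P)
    (hq0 : 0 ≤ q) (hq1 : q < 1) {a : ℝ} (hA : genFun q P X a < ∞) :
    ∫ ω, qBase q (a * X ω) ∂P ≤ (qNorm q P X a).toReal := by
  have hLp := memLp_qBase_of_genFun_lt_top hX hq1 hA
  have hexponent : 1 ≤ ENNReal.ofReal (1 / (1 - q)) :=
    ENNReal.one_le_ofReal.2 ((one_le_div (sub_pos.2 hq1)).2 (by linarith))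
  calc ∫ ω, qBase q (a * X ω) ∂P = ∫ ω, ‖qBase q (a * X ω)‖ ∂P := by
        simp only [Real.norm_of_nonneg (qBase_nonneg _ _)]
    _ = (eLpNorm (fun ω => qBase q (a * X ω)) 1 P).toReal := by
        rw [← lpNorm_one_eq_integral_norm hLp.1, toReal_eLpNorm hLp.1]
    _ ≤ (qNorm q P X a).toReal :=
        ENNReal.toReal_mono hLp.2.ne (eLpNorm_le_eLpNorm_of_exponent_le hexponent hLp.1)

theorem qExp_mul_measure_le_genFun (hX : AEMeasurable X P) (hq : q ≤ 1) {a : ℝ} (ha : 0 ≤ a)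
    (x : ℝ) : qExp q ((a * x : ℝ) : EReal) * P {ω | x ≤ X ω} ≤ genFun q P X a := by
  have hsub : {ω | x ≤ X ω} ⊆
      {ω | qExp q ((a * x : ℝ) : EReal) ≤ qExp q ((a * X ω : ℝ) : EReal)} := fun ω hω =>
    monotone_qExp hq (EReal.coe_le_coe_iff.2 (mul_le_mul_of_nonneg_left hω ha))
  calc qExp q ((a * x : ℝ) : EReal) * P {ω | x ≤ X ω}
      ≤ qExp q ((a * x : ℝ) : EReal) *
          P {ω | qExp q ((a * x : ℝ) : EReal) ≤ qExp q ((a * X ω : ℝ) : EReal)} := by gcongr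
    _ ≤ genFun q P X a := mul_meas_ge_le_lintegral₀
        ((continuous_qExp_coe q).measurable.comp_aemeasurable (hX.const_mul a)) _

theorem qBase_mul_measureReal_rpow_le (hX : AEMeasurable X P) (hq : q < 1) {a : ℝ} (ha : 0 ≤ a)
    (hA : genFun q P X a < ∞) (x : ℝ) :
    qBase q (a * x) * P.real {ω | x ≤ X ω} ^ (1 - q) ≤ (qNorm q P X a).toReal := by
  have hq0 : 0 ≤ 1 - q := sub_nonneg.2 hq.le
  have hmarkov := ENNReal.rpow_le_rpow (qExp_mul_measure_le_genFun hX hq.le ha x) hq0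
  rw [ENNReal.mul_rpow_of_nonneg _ _ hq0, qExp_rpow_one_sub hq.ne] at hmarkov
  have hreal := ENNReal.toReal_mono (ENNReal.rpow_ne_top_of_nonneg hq0 hA.ne) hmarkov
  rwa [ENNReal.toReal_mul, ENNReal.toReal_ofReal (qBase_nonneg _ _), ← ENNReal.toReal_rpow,
    genFun_rpow_one_sub hq] at hreal

theorem genFun_zero [IsProbabilityMeasure P] : genFun q P X 0 = 1 := by
  simp [genFun, qExp_zero]

theorem continuousOn_genFun [IsFiniteMeasure P] (hX : AEMeasurable X P) (hq : q ≤ 1)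
    (hA : ∀ a : ℝ, 0 < a → genFun q P X a < ∞) :
    ContinuousOn (genFun q P X) (Set.Ici 0) := by
  intro b (hb : 0 ≤ b)
  have hmeas (a : ℝ) : AEMeasurable (fun ω => qExp q ((a * X ω : ℝ) : EReal)) P :=
    (continuous_qExp_coe q).measurable.comp_aemeasurable (hX.const_mul a)
  refine tendsto_lintegral_filter_of_dominated_convergence'
    (fun ω => qExp q (((b + 1) * X ω : ℝ) : EReal) + 1) (Eventually.of_forall hmeas) ?_ ?_
    (ae_of_all _ fun ω => ?_)
  · have hlt : ∀ᶠ a in 𝓝[Set.Ici 0] b, a < b + 1 :=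
      eventually_nhdsWithin_of_eventually_nhds (eventually_lt_nhds (lt_add_one b))
    filter_upwards [hlt, eventually_mem_nhdsWithin] with a hab (ha : 0 ≤ a)
    refine ae_of_all _ fun ω => ?_
    rcases le_total 0 (X ω) with h | h
    · exact le_add_right (monotone_qExp hq (EReal.coe_le_coe_iff.2 (by gcongr)))
    · refine le_add_left ((monotone_qExp hq ?_).trans_eq (qExp_zero q))
      exact_mod_cast mul_nonpos_of_nonneg_of_nonpos ha h
  · rw [lintegral_add_right _ measurable_const, lintegral_const, one_mul]
    exact ENNReal.add_ne_top.2 ⟨(hA (b + 1) (by linarith)).ne, measure_ne_top P _⟩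
  · have hcont : Continuous fun a : ℝ => qExp q ((a * X ω : ℝ) : EReal) :=
      (continuous_qExp_coe q).comp (continuous_mul_const (X ω))
    exact hcont.continuousWithinAt

theorem continuousOn_theta [IsProbabilityMeasure P] (hX : AEMeasurable X P) (hq : q ≤ 1)
    (hA : ∀ a : ℝ, 0 < a → genFun q P X a < ∞) :
    ContinuousOn (theta q P X) (Set.Ici 0) := by
  intro b (hb : 0 ≤ b)
  have hden : Tendsto (fun a => genFun q P X a ^ (1 - q)) (𝓝[Set.Ici 0] b)
      (𝓝 (genFun q P X b ^ (1 - q))) :=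
    (ENNReal.continuous_rpow_const.tendsto _).comp (continuousOn_genFun hX hq hA b hb)
  refine ENNReal.Tendsto.div ENNReal.continuous_ofReal.continuousWithinAt ?_ hden
    (Or.inr ENNReal.ofReal_ne_top)
  rcases hb.eq_or_lt with rfl | h
  · right
    simp [genFun_zero]
  · left
    simpa using h

theorem theta_zero (q : ℝ) (P : Measure Ω) (X : Ω → ℝ) : theta q P X 0 = 0 := by
  simp [theta]

theorem exists_theta_eq [IsProbabilityMeasure P] (hX : AEMeasurable X P) (hq : q ≤ 1)
    (hA : ∀ a : ℝ, 0 < a → genFun q P X a < ∞) {t : ℝ} (ht : 0 < t)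
    (ht' : ENNReal.ofReal t < thetaBar q P X) :
    ∃ a ∈ Set.Ioi (0 : ℝ), theta q P X a = ENNReal.ofReal t := by
  obtain ⟨b, hb, hb0⟩ := ((frequently_lt_of_lt_limsup (by isBoundedDefault) ht').and_eventually
    (eventually_gt_atTop (0 : ℝ))).exists
  obtain ⟨a, ha, hat⟩ := isPreconnected_Ici.intermediate_value Set.self_mem_Ici
    (Set.mem_Ici.2 hb0.le) (continuousOn_theta hX hq hA)
    ⟨(theta_zero q P X).trans_le zero_le, hb.le⟩
  refine ⟨a, Set.mem_Ioi.2 (lt_of_le_of_ne ha ?_), hat⟩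
  rintro rfl
  rw [theta_zero] at hat
  exact (ENNReal.ofReal_pos.2 ht).ne hat

end GeneratingFunction

section RateFunction

variable {Ω : Type*} [MeasurableSpace Ω] {P : Measure Ω} [IsProbabilityMeasure P] {X : Ω → ℝ}
  {q : ℝ}

theorem exists_mul_sub_Phi_eq (hX : AEMeasurable X P) (hq : q < 1)
    (hA : ∀ a : ℝ, 0 < a → genFun q P X a < ∞) {t : ℝ} (ht : 0 < t)
    (ht' : ENNReal.ofReal t < thetaBar q P X) :
    ∃ a : ℝ, 0 < a ∧ 0 < (qNorm q P X a).toReal ∧ ∀ x : ℝ, t * x - Phi q P X t =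
      ((1 + (1 - q) * (a * x)) / (qNorm q P X a).toReal - 1) / (1 - q) := by
  have hex := exists_theta_eq hX hq.le hA ht ht'
  have ha : 0 < aOfTheta q P X t := Function.invFunOn_mem hex
  have hat : theta q P X (aOfTheta q P X t) = ENNReal.ofReal t := Function.invFunOn_eq hex
  have hPhi : Phi q P X t = (1 - (qNorm q P X (aOfTheta q P X t)).toReal⁻¹) / (1 - q) := by
    rw [Phi, qLog_two_sub q ENNReal.toReal_nonneg, toReal_genFun_rpow_one_sub hq]
  set a := aOfTheta q P X t
  have hq0 : 0 < 1 - q := sub_pos.2 hq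
  have ht_eq : a / (qNorm q P X a).toReal = t := by
    simpa [theta_eq_div_qNorm hq, ha.le, ht.le] using congrArg ENNReal.toReal hat
  have hN : 0 < (qNorm q P X a).toReal := by
    refine ENNReal.toReal_nonneg.lt_of_ne fun h => ht.ne ?_
    rw [← ht_eq, ← h, div_zero]
  refine ⟨a, ha, hN, fun x => ?_⟩
  rw [hPhi, ← ht_eq]
  field_simp
  ring

theorem exists_toReal_qNorm_lt_of_rate_pos (hX : AEMeasurable X P) (hq : q < 1)
    (hA : ∀ a : ℝ, 0 < a → genFun q P X a < ∞) {x : ℝ} (hx : 0 < rate q P X x) :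
    ∃ a : ℝ, 0 < a ∧ (qNorm q P X a).toReal < 1 + (1 - q) * (a * x) := by
  simp only [rate, lt_iSup_iff] at hx
  obtain ⟨t, ⟨ht, ht'⟩, hpos⟩ := hx
  obtain ⟨a, ha, hN, hterm⟩ := exists_mul_sub_Phi_eq hX hq hA ht ht'
  rw [hterm, EReal.coe_pos, div_pos_iff_of_pos_right (sub_pos.2 hq), sub_pos, one_lt_div hN] at hpos
  exact ⟨a, ha, hpos⟩

theorem rate_le_neg_qLog_measureReal (hX : AEMeasurable X P) (hq : q < 1)
    (hA : ∀ a : ℝ, 0 < a → genFun q P X a < ∞) {x : ℝ} (hx : 0 < P.real {ω | x ≤ X ω}) :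
    rate q P X x ≤ ((-qLog (2 - q) (P.real {ω | x ≤ X ω}) : ℝ) : EReal) := by
  refine iSup₂_le fun t ⟨ht, ht'⟩ => EReal.coe_le_coe_iff.2 ?_
  obtain ⟨a, ha, hN, hterm⟩ := exists_mul_sub_Phi_eq hX hq hA ht ht'
  have hmarkov : (1 + (1 - q) * (a * x)) / (qNorm q P X a).toReal ≤
      (P.real {ω | x ≤ X ω} ^ (1 - q))⁻¹ := by
    rw [div_le_iff₀ hN, ← div_eq_inv_mul, le_div_iff₀ (by positivity)]
    refine le_trans ?_ (qBase_mul_measureReal_rpow_le hX hq ha.le (hA a ha) x)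
    exact mul_le_mul_of_nonneg_right (le_max_left _ _) (by positivity)
  rw [hterm, qLog_two_sub q hx.le, ← neg_div, neg_sub]
  exact div_le_div_of_nonneg_right (sub_le_sub_right hmarkov 1) (sub_nonneg.2 hq.le)

theorem measure_le_eq_zero_of_rate_eq_top (hX : AEMeasurable X P) (hq : q < 1)
    (hA : ∀ a : ℝ, 0 < a → genFun q P X a < ∞) {x : ℝ} (hx : rate q P X x = ⊤) :
    P {ω | x ≤ X ω} = 0 := by
  by_contra hP
  have hpos : 0 < P.real {ω | x ≤ X ω} := ENNReal.toReal_pos hP (measure_ne_top P _)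
  have hbound := rate_le_neg_qLog_measureReal hX hq hA hpos
  rw [hx, top_le_iff] at hbound
  exact EReal.coe_ne_top _ hbound

end RateFunction

section SampleMean

variable {Ω : Type*} [MeasurableSpace Ω] {P : Measure Ω} {X : ℕ → Ω → ℝ} {q : ℝ}

theorem measure_natCast_mul_le_sum_eq_zero (hident : ∀ k, IdentDistrib (X k) (X 0) P P) {x : ℝ}
    (h0 : P {ω | x ≤ X 0 ω} = 0) {n : ℕ} (hn : 1 ≤ n) :
    P {ω | n * x ≤ ∑ k ∈ Finset.range n, X k ω} = 0 := by
  have hnull (k : ℕ) : P {ω | x ≤ X k ω} = 0 :=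
    ((hident k).measure_mem_eq measurableSet_Ici).trans h0
  refine measure_mono_null (fun ω hω => ?_) (measure_iUnion_null hnull)
  by_contra hlt
  simp only [Set.mem_iUnion, Set.mem_ofPred_eq, not_exists, not_le] at hω hlt
  refine hω.not_gt ?_
  simpa using Finset.sum_lt_sum_of_nonempty (Finset.nonempty_range_iff.2 (by omega))
    fun k (_ : k ∈ Finset.range n) => hlt k

variable [IsProbabilityMeasure P]

theorem tendsto_rpow_mul_measureReal_natCast_mul_le_sum (hindep : iIndepFun X P)
    (hident : ∀ k, IdentDistrib (X k) (X 0) P P) (hq0 : 0 < q) (hq1 : q < 1)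
    (hA : ∀ a : ℝ, 0 < a → genFun q P (X 0) a < ∞) {x : ℝ} (hx : 0 < rate q P (X 0) x) :
    Tendsto (fun n : ℕ => (n : ℝ) ^ (1 / (1 - q) - 1) *
      P.real {ω | n * x ≤ ∑ k ∈ Finset.range n, X k ω}) atTop (𝓝 0) := by
  have hX : AEMeasurable (X 0) P := (hident 0).aemeasurable_fst
  have hq : 0 < 1 - q := sub_pos.2 hq1
  obtain ⟨a, ha, hax⟩ := exists_toReal_qNorm_lt_of_rate_pos hX hq1 hA hx
  have hmeas : Measurable fun y : ℝ => qBase q (a * y) :=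
    ((continuous_qBase q).comp (continuous_const_mul a)).measurable
  have hlim := tendsto_rpow_mul_measureReal_le_sum (Z := fun k ω => qBase q (a * X k ω))
    (hindep.comp (fun _ y => qBase q (a * y)) fun _ => hmeas) (fun k => (hident k).comp hmeas)
    (ae_of_all _ fun ω => qBase_nonneg _ _) ((one_lt_div hq).2 (by linarith))
    (memLp_qBase_of_genFun_lt_top hX hq1 (hA a ha))
    ((integral_qBase_le_toReal_qNorm hX hq0.le hq1 (hA a ha)).trans_lt hax)
  refine squeeze_zero (fun n => by positivity) (fun n => ?_) hlim
  refine mul_le_mul_of_nonneg_left (measureReal_mono fun ω hω => ?_) (by positivity)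
  have hsum : (n : ℝ) * x ≤ ∑ k ∈ Finset.range n, X k ω := hω
  calc n * (1 + (1 - q) * (a * x)) = n + (1 - q) * (a * (n * x)) := by ring
    _ ≤ n + (1 - q) * (a * ∑ k ∈ Finset.range n, X k ω) := by gcongr
    _ = ∑ k ∈ Finset.range n, (1 + (1 - q) * (a * X k ω)) := by
        simp [Finset.sum_add_distrib, Finset.mul_sum]
    _ ≤ ∑ k ∈ Finset.range n, qBase q (a * X k ω) := by
        gcongr
        exact le_max_left _ _

theorem eventually_measure_natCast_mul_le_sum_le (hindep : iIndepFun X P)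
    (hident : ∀ k, IdentDistrib (X k) (X 0) P P) (hq0 : 0 < q) (hq1 : q < 1)
    (hA : ∀ a : ℝ, 0 < a → genFun q P (X 0) a < ∞) {x : ℝ} (hx : 0 < rate q P (X 0) x) (v : ℝ) :
    ∀ᶠ n : ℕ in atTop, P {ω | n * x ≤ ∑ k ∈ Finset.range n, X k ω} ≤
      n * (qExp q ((n * v : ℝ) : EReal))⁻¹ := by
  have hlim := ENNReal.tendsto_ofReal
    (tendsto_rpow_mul_measureReal_natCast_mul_le_sum hindep hident hq0 hq1 hA hx)
  rw [ENNReal.ofReal_zero] at hlim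
  have hpos : 0 < (qExp q v)⁻¹ := ENNReal.inv_pos.2 (qExp_coe_ne_top hq1.le v)
  filter_upwards [hlim.eventually_lt_const hpos, eventually_ge_atTop 1] with n hlt hn
  have hn1 : (1 : ℝ) ≤ n := by exact_mod_cast hn
  have hn0 : (0 : ℝ) < n := by linarith
  have hn_ne : (n : ℝ≥0∞) ≠ 0 := by exact_mod_cast hn0.ne'
  rw [ENNReal.ofReal_mul (by positivity), ofReal_measureReal, ← ENNReal.ofReal_rpow_of_pos hn0,
    ENNReal.ofReal_natCast] at hlt
  set S := {ω | n * x ≤ ∑ k ∈ Finset.range n, X k ω}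
  set α := 1 / (1 - q)
  have hpow_ne_zero (y : ℝ) : (n : ℝ≥0∞) ^ y ≠ 0 := by simp [hn_ne]
  have hpow_ne_top (y : ℝ) : (n : ℝ≥0∞) ^ y ≠ ∞ := by simp [hn_ne]
  calc P S = (n : ℝ≥0∞) ^ (1 - α) * ((n : ℝ≥0∞) ^ (α - 1) * P S) := by
        rw [← mul_assoc, ← ENNReal.rpow_add _ _ hn_ne (ENNReal.natCast_ne_top n)]
        simp
    _ ≤ (n : ℝ≥0∞) ^ (1 - α) * (qExp q v)⁻¹ := by gcongr
    _ = n * ((n : ℝ≥0∞) ^ α * qExp q v)⁻¹ := by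
        rw [ENNReal.mul_inv (Or.inl (hpow_ne_zero α)) (Or.inl (hpow_ne_top α)), ← mul_assoc,
          ENNReal.rpow_sub _ _ hn_ne (ENNReal.natCast_ne_top n), ENNReal.rpow_one, div_eq_mul_inv]
    _ ≤ n * (qExp q ((n * v : ℝ) : EReal))⁻¹ := by
        gcongr
        simpa only [ENNReal.ofReal_natCast] using qExp_mul_le hq1.le hn1 v

theorem eventually_measure_mean_le (hindep : iIndepFun X P)
    (hident : ∀ k, IdentDistrib (X k) (X 0) P P) (hq0 : 0 < q) (hq1 : q < 1)
    (hA : ∀ a : ℝ, 0 < a → genFun q P (X 0) a < ∞) (x : ℝ) :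
    ∀ᶠ n : ℕ in atTop, P {ω | x ≤ (1 / (n : ℝ)) * ∑ k ∈ Finset.range n, X k ω} ≤
      (n : ℝ≥0∞) * qExp (2 - q)
        (((n / q : ℝ) : EReal) - (n : EReal) * rate q P (X 0) x) := by
  suffices h : ∀ᶠ n : ℕ in atTop, P {ω | n * x ≤ ∑ k ∈ Finset.range n, X k ω} ≤
      (n : ℝ≥0∞) * qExp (2 - q) (((n / q : ℝ) : EReal) - (n : EReal) * rate q P (X 0) x) by
    filter_upwards [h, eventually_ge_atTop 1] with n hle hn
    have hn0 : (0 : ℝ) < n := by exact_mod_cast hn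
    simpa only [one_div, ← div_eq_inv_mul, le_div_iff₀' hn0] using hle
  rcases le_or_gt (rate q P (X 0) x) ((1 / q : ℝ) : EReal) with hle | hlt
  · filter_upwards [eventually_ge_atTop 1] with n hn
    have hexponent : 0 ≤ ((n / q : ℝ) : EReal) - (n : EReal) * rate q P (X 0) x := by
      rw [EReal.sub_nonneg (Or.inl (EReal.coe_ne_top _)) (Or.inl (EReal.coe_ne_bot _)),
        div_eq_mul_one_div (n : ℝ), EReal.coe_mul]
      exact mul_le_mul_of_nonneg_left hle (by positivity)
    exact prob_le_one.trans (one_le_natCast_mul_qExp_two_sub hq1.le hexponent hn)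
  rcases eq_or_ne (rate q P (X 0) x) ⊤ with htop | htop
  · have hnull := measure_le_eq_zero_of_rate_eq_top (hident 0).aemeasurable_fst hq1 hA htop
    filter_upwards [eventually_ge_atTop 1] with n hn
    rw [measure_natCast_mul_le_sum_eq_zero hident hnull hn]
    exact zero_le
  · have hpos : 0 < rate q P (X 0) x :=
      (EReal.coe_nonneg.2 (one_div_nonneg.2 hq0.le)).trans_lt hlt
    obtain ⟨ρ, hρ⟩ : ∃ ρ : ℝ, rate q P (X 0) x = ρ :=
      ⟨_, (EReal.coe_toReal htop (bot_le.trans_lt hlt).ne').symm⟩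
    filter_upwards [eventually_measure_natCast_mul_le_sum_le hindep hident hq0 hq1 hA hpos
      (ρ - 1 / q)] with n hn
    have hexponent : ((n * (ρ - 1 / q) : ℝ) : EReal) =
        -(((n / q : ℝ) : EReal) - (n : EReal) * ρ) := by
      rw [← EReal.coe_natCast, ← EReal.coe_mul, ← EReal.coe_sub, ← EReal.coe_neg]
      congr 1
      ring
    rwa [hρ, qExp_two_sub, ← hexponent]

end SampleMean

end QDeformed

theorem theorem2 {Ω : Type*} [MeasurableSpace Ω] (P : Measure Ω) [IsProbabilityMeasure P]
    (X : ℕ → Ω → ℝ) (hmeas : ∀ k, Measurable (X k)) (hindep : iIndepFun X P)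
    (hident : ∀ k, IdentDistrib (X k) (X 0) P P)
    (q : ℝ) (hq0 : 0 < q) (hq1 : q < 1)
    (hA : ∀ a : ℝ, 0 < a → QDeformed.genFun q P (X 0) a < ∞) :
    ∃ ξ : ℕ → ℝ → ℝ≥0∞,
      (∀ n : ℕ, 1 ≤ n → ∀ x : ℝ,
        P {ω | x ≤ (1 / (n : ℝ)) * ∑ k ∈ Finset.range n, X k ω} ≤ ξ n x) ∧
      ∀ x : ℝ, QDeformed.AsympEquiv (fun n => ξ n x)
        (fun n => (n : ℝ≥0∞) *
          QDeformed.qExp (2 - q)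
            (((n / q : ℝ) : EReal) - (n : EReal) * QDeformed.rate q P (X 0) x)) := by
  refine ⟨fun n x => max (P {ω | x ≤ (1 / (n : ℝ)) * ∑ k ∈ Finset.range n, X k ω})
    ((n : ℝ≥0∞) * QDeformed.qExp (2 - q)
      (((n / q : ℝ) : EReal) - (n : EReal) * QDeformed.rate q P (X 0) x)),
    fun n _ x => le_max_left _ _, fun x => ⟨fun _ => 1, tendsto_const_nhds, ?_⟩⟩
  filter_upwards [QDeformed.eventually_measure_mean_le hindep hident hq0 hq1 hA x] with n hn
  rw [one_mul, max_eq_right hn]
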